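/- Let $p$ be a prime. A (finite, multi-sorted) relational structure $\mathcal H=(\{H_i\}_{i\in[k]};R_1,\dots,R_m)$ consists of finitely many pairwise disjoint finite domains $H_i$ and finitely many relations $R_j\subseteq H_{i_1}\times\dots\times H_{i_\ell}$. A relation $R(x_1,\dots,x_n)$ over the domains is $p$-mpp-definable in $\mathcal H$ if there is a conjunction $\Phi(x_1,\dots,x_n,y_1,\dots,y_s)$, in variables ranging over specified domains, of equalities between variables with the same domain and of relations of $\mathcal H$ applied to variables with the right domains, such that $R(a_1,\dots,a_n)$ holds if and only if the number of $(b_1,\dots,b_s)$ with $\Phi(a_1,\dots,a_n,b_1,\dots,b_s)$ is not divisible by $p$. Let $\langle\mathcal H\rangle_p$ be the set of all $p$-mpp-definable relations. $\mathcal H$ is $p$-conservative if every subset of every $H_i$ is $p$-mpp-definable as a unary relation. $\mathcal H$ is strongly $p$-rectangular if every $R\in\langle\mathcal H\rangle_p$ of arity $n\ge 2$ is rectangular, that is, for every $I\subsetneq[n]$, writing tuples as pairs of their restrictions to $I$ and to $[n]\setminus I$, $(a,c),(a,d),(b,c)\in R$ implies $(b,d)\in R$. A ternary operation is a family $f=\{f_i\}$,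 $f_i:H_i^3\to H_i$; it is a polymorphism of a set of relations if, applied coordinatewise, it preserves each of them, and it is Mal'tsev if $f_i(x,y,y)=f_i(y,y,x)=x$ for all $i$ and all $x,y\in H_i$. Let $\mathcal H^{\dagger p}$ be the expansion of $\mathcal H$ by one relation $Q_f\in\langle\mathcal H\rangle_p$ not preserved by $f$, for each ternary polymorphism $f$ of $\mathcal H$ that is not a polymorphism of $\langle\mathcal H\rangle_p$. For a structure $\mathcal G$ on the domains $H_i$, let $\Upsilon_3(\mathcal G)$ be the set of all solutions of its ternary indicator problem: the relation with coordinate set $H^{(3)}=\bigcup_i H_i^3$ (the coordinate $t\in H_i^3$ ranging over $H_i$) consisting of all $g$ such that $(g(t_1),\dots,g(t_s))\in R$ whenever $R$ is an $s$-ary relation of $\mathcal G$ and $t_1,\dots,t_s$ are triples over the domains of the corresponding coordinates of $R$ with $(t_1[j],\dots,t_s[j])\in R$ for $j=1,2,3$. Let $I_{\mathcal H}=\{(a,b,b)\mid a,b\in H_i,\ i\in[k]\}$ and $J_{\mathcal H}=\{(b,b,a)\mid a,b\in H_i,\ a\ne b,\ i\in[k]\}$. Let $\mathbf a_{\mathcal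 H},\mathbf b_{\mathcal H}$ be the tuples indexed by $I_{\mathcal H}$ whose entries at $(a,b,b)$ are $a$ and $b$, and let $\mathbf c_{\mathcal H},\mathbf d_{\mathcal H}$ be the tuples indexed by $J_{\mathcal H}$ whose entries at $(c,c,d)$ are $c$ and $d$. A $p$-indicator rectangularity obstruction is a relation $R\subseteq\mathrm{pr}_{I_{\mathcal H}\cup J_{\mathcal H}}\Upsilon_3(\mathcal H^{\dagger p})$ with $(\mathbf a_{\mathcal H},\mathbf c_{\mathcal H}),(\mathbf b_{\mathcal H},\mathbf c_{\mathcal H}),(\mathbf b_{\mathcal H},\mathbf d_{\mathcal H})\in R$ and $(\mathbf a_{\mathcal H},\mathbf d_{\mathcal H})\notin R$. $\mathcal H$ admits such an obstruction if some $p$-indicator rectangularity obstruction is $p$-mpp-definable in $\mathcal H$. Theorem. Let $p$ be a prime and let $\mathcal H$ be a $p$-conservative structure. Then $\langle\mathcal H\rangle_p$ has a Mal'tsev polymorphism or $\mathcal H$ admits a $p$-indicator rectangularity obstruction; and if $\mathcal H$ admits a $p$-indicator rectangularity obstruction, then $\mathcal H$ is not strongly $p$-rectangular. -/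

import Mathlib

namespace ModCSP

universe u v w

/-- A multi-sorted relational signature over the set of sorts `ι`: every symbol has an arity and a
type, i.e. a sort for each of its argument places. -/
structure Signature (ι : Type u) where
  Symbol : Type v
  arity : Symbol → ℕ
  type : (r : Symbol) → Fin (arity r) → ι

/-- A multi-sorted relational structure with domains `H i` (one for each sort `i`; they are
automatically disjoint). It is finite if there are finitely many sorts, domains and symbols. -/
structure RelStructure {ι : Type u} (σ : Signature.{u, v} ι) (H : ι → Type w) where
  rel : (r : σ.Symbol) → Set ((q : Fin (σ.arity r)) → H (σ.type r q))

section Formulas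

variable {ι : Type u} {H : ι → Type w} {σ : Signature.{u, v} ι}

/-- The variables of sort `i`, when the variables `W` are assigned sorts by `τ`. -/
def VarOfSort {W : Type*} (τ : W → ι) (i : ι) : Type _ := {x : W // τ x = i}

/-- The value of a variable of sort `i` under an assignment; it is an element of `H i`. -/
def VarOfSort.value {W : Type*} {τ : W → ι} {i : ι} (x : VarOfSort τ i)
    (s : (x : W) → H (τ x)) : H i :=
  x.2 ▸ s x.1

/-- Atomic formulas over a signature in the sorted variables `W`: equalities of two variables of
the same sort, and symbols applied to variables of the right sorts. -/
inductive Atom (σ : Signature.{u, v} ι) {W : Type*} (τ : W → ι) : Type _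
  | eq (i : ι) (x y : VarOfSort τ i)
  | rel (r : σ.Symbol) (args : (q : Fin (σ.arity r)) → VarOfSort τ (σ.type r q))

/-- Truth of an atomic formula in a structure under an assignment. -/
def Atom.Holds (𝓗 : RelStructure σ H) {W : Type*} {τ : W → ι} (s : (x : W) → H (τ x)) :
    Atom σ τ → Prop
  | .eq _ x y => x.value s = y.value s
  | .rel r args => (fun q => (args q).value s) ∈ 𝓗.rel r

/-- The assignment to the variables `V ⊕ Y` made of an assignment to `V` and one to `Y`. -/
def joinAssignment {V Y : Type*} {τ : V → ι} {ρ : Y → ι} (a : (x : V) → H (τ x))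
    (b : (y : Y) → H (ρ y)) : (x : V ⊕ Y) → H (Sum.elim τ ρ x)
  | .inl x => a x
  | .inr y => b y

/-- `#ext_Φ(a)`: the number of assignments `b` to the variables `y₁, …, yₛ` (of sorts `ρ`) such
that the conjunction `Φ` of atomic formulas holds for `(a, b)`. -/
noncomputable def numExt (𝓗 : RelStructure σ H) {V : Type*} {τ : V → ι} {s : ℕ} {ρ : Fin s → ι}
    (Φ : List (Atom σ (Sum.elim τ ρ))) (a : (x : V) → H (τ x)) : ℕ :=
  Nat.card {b : (y : Fin s) → H (ρ y) // ∀ A ∈ Φ, A.Holds 𝓗 (joinAssignment a b)}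

/-- `R` is `p`-mpp-definable in `𝓗`: there is a conjunction `Φ` of atomic formulas in the free
variables `V` and further variables `y₁, …, yₛ` such that `R` holds for `a` exactly if the number
of extensions of `a` to a solution of `Φ` is not divisible by `p`. -/
def MppDefinable (𝓗 : RelStructure σ H) (p : ℕ) {V : Type*} (τ : V → ι)
    (R : Set ((x : V) → H (τ x))) : Prop :=
  ∃ (s : ℕ) (ρ : Fin s → ι) (Φ : List (Atom σ (Sum.elim τ ρ))),
    ∀ a : (x : V) → H (τ x), a ∈ R ↔ ¬ numExt 𝓗 Φ a ≡ 0 [MOD p]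

/-- The members of `⟨𝓗⟩_p`, the set of all `p`-mpp-definable relations of `𝓗`. -/
structure MppRelation (𝓗 : RelStructure σ H) (p : ℕ) where
  arity : ℕ
  type : Fin arity → ι
  rel : Set ((q : Fin arity) → H (type q))
  definable : MppDefinable 𝓗 p type rel

/-- `𝓗` is `p`-conservative: each subset of each domain is `p`-mpp-definable, as a unary
relation. -/
def IsConservative (𝓗 : RelStructure σ H) (p : ℕ) : Prop :=
  ∀ (i : ι) (A : Set (H i)), MppDefinable 𝓗 p (fun _ : Fin 1 => i) {x | x 0 ∈ A}

end Formulas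

section Polymorphisms

variable {ι : Type u} {H : ι → Type w} {σ : Signature.{u, v} ι}

/-- A ternary multi-sorted operation on the domains `H i`. -/
def TernaryOp (H : ι → Type w) : Type _ := (i : ι) → H i → H i → H i → H i

/-- The operation `f` is a polymorphism of the relation `R`. -/
def TernaryOp.Preserves (f : TernaryOp H) {V : Type*} {τ : V → ι}
    (R : Set ((x : V) → H (τ x))) : Prop :=
  ∀ a ∈ R, ∀ b ∈ R, ∀ c ∈ R, (fun x => f (τ x) (a x) (b x) (c x)) ∈ R

/-- The Mal'tsev identities, on every domain. -/
def TernaryOp.IsMaltsev (f : TernaryOp H) : Prop :=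
  ∀ (i : ι) (x y : H i), f i x y y = x ∧ f i y y x = x

/-- `Pol₃(𝓗)`, the ternary polymorphisms of `𝓗`. -/
def Pol3 (𝓗 : RelStructure σ H) : Set (TernaryOp H) :=
  {f | ∀ r : σ.Symbol, f.Preserves (𝓗.rel r)}

/-- `Pol₃(⟨𝓗⟩_p)`, the common ternary polymorphisms of all `p`-mpp-definable relations. -/
def Pol3Mpp (𝓗 : RelStructure σ H) (p : ℕ) : Set (TernaryOp H) :=
  {f | ∀ Q : MppRelation 𝓗 p, f.Preserves Q.rel}

/-- `⟨𝓗⟩_p` has a Mal'tsev polymorphism. -/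
def HasMppMaltsev (𝓗 : RelStructure σ H) (p : ℕ) : Prop :=
  ∃ f ∈ Pol3Mpp 𝓗 p, f.IsMaltsev

end Polymorphisms

section Rectangularity

variable {ι : Type u} {H : ι → Type w} {σ : Signature.{u, v} ι}

open Classical in
/-- The tuple `(a, c)` whose `I`-part is `a` and whose part outside `I` is `c`. -/
noncomputable def glue {V : Type*} {τ : V → ι} (I : Set V)
    (a : (x : I) → H (τ x)) (c : (x : (Iᶜ : Set V)) → H (τ x)) : (x : V) → H (τ x) :=
  fun x => if h : x ∈ I then a ⟨x, h⟩ else c ⟨x, h⟩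

/-- `R` is rectangular: for each proper subset `I` of its coordinates it is rectangular as a
binary relation between its `I`-parts and its parts outside `I`. -/
def IsRectangular {V : Type*} {τ : V → ι} (R : Set ((x : V) → H (τ x))) : Prop :=
  ∀ I : Set V, I ≠ Set.univ → ∀ (a b : (x : I) → H (τ x)) (c d : (x : (Iᶜ : Set V)) → H (τ x)),
    glue I a c ∈ R → glue I a d ∈ R → glue I b c ∈ R → glue I b d ∈ R

/-- `𝓗` is strongly `p`-rectangular: all relations in `⟨𝓗⟩_p` of arity at least 2 are
rectangular. -/
def IsStronglyRectangular (𝓗 : RelStructure σ H) (p : ℕ) : Prop :=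
  ∀ Q : MppRelation 𝓗 p, 2 ≤ Q.arity → IsRectangular Q.rel

end Rectangularity

section Indicator

variable {ι : Type u} {H : ι → Type w} {σ : Signature.{u, v} ι}

/-- `H⁽³⁾`, the disjoint union of the cubes `H i × H i × H i`: the variables of the ternary
indicator problem. -/
abbrev Triple (H : ι → Type w) : Type _ := Σ i : ι, H i × H i × H i

/-- `Υ₃(𝓗)`, the set of all solutions of the ternary indicator problem of `𝓗`. The variables are
the triples, a triple over `H i` taking values in `H i`. The constraints are: for each symbol `r`
and each sequence `t` of triples of the right sorts such that all three of its coordinate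
sequences belong to `r`, the sequence of variables `t` satisfies `r`. -/
def indicator (𝓗 : RelStructure σ H) : Set ((x : Triple H) → H x.1) :=
  {g | ∀ (r : σ.Symbol)
      (t : (q : Fin (σ.arity r)) → H (σ.type r q) × H (σ.type r q) × H (σ.type r q)),
      (fun q => (t q).1) ∈ 𝓗.rel r → (fun q => (t q).2.1) ∈ 𝓗.rel r →
      (fun q => (t q).2.2) ∈ 𝓗.rel r → (fun q => g ⟨σ.type r q, t q⟩) ∈ 𝓗.rel r}

/-- The ternary polymorphisms of `𝓗` that are not polymorphisms of `⟨𝓗⟩_p`. -/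
def BadPol (𝓗 : RelStructure σ H) (p : ℕ) : Type _ :=
  {f : TernaryOp H // f ∈ Pol3 𝓗 ∧ f ∉ Pol3Mpp 𝓗 p}

/-- A relation in `⟨𝓗⟩_p` that `f` does not preserve. -/
noncomputable def BadPol.witness {𝓗 : RelStructure σ H} {p : ℕ} (f : BadPol 𝓗 p) :
    MppRelation 𝓗 p :=
  Classical.choose (not_forall.mp f.2.2)

/-- The signature of `𝓗^†p`: a new symbol is added for each `f` in `Pol₃(𝓗) ∖ Pol₃(⟨𝓗⟩_p)`. -/
noncomputable def daggerSignature (𝓗 : RelStructure σ H) (p : ℕ) : Signature ι where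
  Symbol := σ.Symbol ⊕ BadPol 𝓗 p
  arity
    | .inl r => σ.arity r
    | .inr f => f.witness.arity
  type
    | .inl r => σ.type r
    | .inr f => f.witness.type

/-- `𝓗^†p`, the expansion of `𝓗` by one `p`-mpp-definable relation not preserved by `f`, for each
ternary polymorphism `f` of `𝓗` that is not a polymorphism of `⟨𝓗⟩_p`. -/
noncomputable def dagger (𝓗 : RelStructure σ H) (p : ℕ) :
    RelStructure (daggerSignature 𝓗 p) H where
  rel
    | .inl r => 𝓗.rel r
    | .inr f => f.witness.rel

/-- `I_H`, the set of all triples `(a, b, b)`. -/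
def setI (H : ι → Type w) : Set (Triple H) := {x | ∃ (i : ι) (a b : H i), x = ⟨i, (a, b, b)⟩}

/-- `J_H`, the set of all triples `(b, b, a)` with `a ≠ b`. -/
def setJ (H : ι → Type w) : Set (Triple H) :=
  {x | ∃ (i : ι) (a b : H i), a ≠ b ∧ x = ⟨i, (b, b, a)⟩}

/-- The tuple `a_H`: its entry at `(a, b, b)` is `a`. -/
def tupA (H : ι → Type w) (x : setI H) : H x.1.1 := x.1.2.1

/-- The tuple `b_H`: its entry at `(a, b, b)` is `b`. -/
def tupB (H : ι → Type w) (x : setI H) : H x.1.1 := x.1.2.2.1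

/-- The tuple `c_H`: its entry at `(c, c, d)` is `c`. -/
def tupC (H : ι → Type w) (x : setJ H) : H x.1.1 := x.1.2.1

/-- The tuple `d_H`: its entry at `(c, c, d)` is `d`. -/
def tupD (H : ι → Type w) (x : setJ H) : H x.1.1 := x.1.2.2.2

open Classical in
/-- The tuple `(x, y)` with coordinate set `I_H ∪ J_H` (a disjoint union) made of a tuple `x` over
`I_H` and a tuple `y` over `J_H`. -/
noncomputable def pairIJ (x : (v : setI H) → H v.1.1) (y : (v : setJ H) → H v.1.1) :
    (v : ↥(setI H ∪ setJ H)) → H v.1.1 :=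
  fun v => if h : v.1 ∈ setI H then x ⟨v.1, h⟩ else y ⟨v.1, v.2.resolve_left h⟩

/-- The projection to the coordinates in `K` of a relation with coordinate set `H⁽³⁾`. -/
def proj (K : Set (Triple H)) (R : Set ((x : Triple H) → H x.1)) : Set ((v : K) → H v.1.1) :=
  (fun g v => g v.1) '' R

/-- `R` is a `p`-indicator rectangularity obstruction. -/
def IsIndicatorObstruction (𝓗 : RelStructure σ H) (p : ℕ)
    (R : Set ((v : ↥(setI H ∪ setJ H)) → H v.1.1)) : Prop :=
  R ⊆ proj (setI H ∪ setJ H) (indicator (dagger 𝓗 p)) ∧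
    pairIJ (tupA H) (tupC H) ∈ R ∧
    pairIJ (tupB H) (tupC H) ∈ R ∧
    pairIJ (tupB H) (tupD H) ∈ R ∧
    pairIJ (tupA H) (tupD H) ∉ R

/-- `𝓗` admits a `p`-indicator rectangularity obstruction: one that is `p`-mpp-definable
in `𝓗`. -/
def AdmitsIndicatorObstruction (𝓗 : RelStructure σ H) (p : ℕ) : Prop :=
  ∃ R : Set ((v : ↥(setI H ∪ setJ H)) → H v.1.1),
    IsIndicatorObstruction 𝓗 p R ∧
      MppDefinable 𝓗 p (fun v : ↥(setI H ∪ setJ H) => v.1.1) R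

end Indicator

end ModCSP

namespace ModCSP

universe u v v' w

open scoped Classical

set_option linter.unusedSectionVars false

/-! ### Closure properties of counting functions modulo `p`. -/

section Calculus

variable {ι : Type u} {H : ι → Type w} {σ : Signature.{u, v} ι}

/-! Restricted to `setI H ∪ setJ H`, the three projections of the indicator problem are the pairs
(a, c), (b, c) and (b, d). They always solve the problem for `dagger 𝓗 p`. If (a, d) also extends to
a solution, that solution is a Mal'tsev operation, and it preserves every definable relation because
the added relations rule out all other polymorphisms of `𝓗`. Otherwise it suffices to find a
definable relation between these three tuples and the projection of the solution set; this relation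
is an obstruction. That an obstruction refutes strong rectangularity is immediate: its split into
the two coordinate sets violates rectangularity.

The difficulty is that projecting means counting modulo `p`, and the number of extensions of one of
the three tuples may vanish. The proof works with functions into `ZMod p` that count extensions
(`IsDefFun`). They are closed under products and sums over variables, and by Fermat under passing to
the indicator of the support; conservativity adds constants and restrictions to subsets. A nonzero
sum has a nonzero term, so summing a variable out never leaves the true projection. It remains to
keep three values nonzero. By `exists_twoValued` the three tuples may be assumed to take at most two
values at each variable. Then `exists_weight` supplies a definable weight for which all three sums
over one variable are nonzero. Restriction to a subset is enough, except for `p = 2` when the sums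
over the two values are 0, 1, 1. There the weight must depend on a second coordinate; it comes from
a 2×2 block found by `exists_isDefMat_row` and transformed by `IsDefBlock.of_row`. -/

/-- Substitution of variables for variables of the same sorts. -/
def VarOfSort.subst {W W' : Type*} {τ : W → ι} {τ' : W' → ι}
    (θ : (x : W) → VarOfSort τ' (τ x)) {i : ι} (x : VarOfSort τ i) : VarOfSort τ' i :=
  ⟨(θ x.1).1, (θ x.1).2.trans x.2⟩

theorem VarOfSort.value_subst {W W' : Type*} {τ : W → ι} {τ' : W' → ι}
    (θ : (x : W) → VarOfSort τ' (τ x)) {i : ι} (x : VarOfSort τ i) (s : (x : W') → H (τ' x)) :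
    (x.subst θ).value s = x.value (fun w => (θ w).value s) := by
  obtain ⟨x, rfl⟩ := x
  rfl

/-- Substitution of variables in an atomic formula. -/
def Atom.subst {W W' : Type*} {τ : W → ι} {τ' : W' → ι}
    (θ : (x : W) → VarOfSort τ' (τ x)) : Atom σ τ → Atom σ τ'
  | .eq i x y => .eq i (x.subst θ) (y.subst θ)
  | .rel r args => .rel r fun q => (args q).subst θ

theorem Atom.holds_subst (𝓗 : RelStructure σ H) {W W' : Type*} {τ : W → ι} {τ' : W' → ι}
    (θ : (x : W) → VarOfSort τ' (τ x)) (A : Atom σ τ) (s : (x : W') → H (τ' x)) :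
    (A.subst θ).Holds 𝓗 s ↔ A.Holds 𝓗 (fun w => (θ w).value s) := by
  cases A <;> simp only [Atom.subst, Atom.Holds, VarOfSort.value_subst]

/-- `F` counts, modulo `p`, the extensions of an assignment to a solution of some conjunction of
atomic formulas. -/
def IsDefFun (𝓗 : RelStructure σ H) (p : ℕ) {V : Type*} (τ : V → ι)
    (F : ((x : V) → H (τ x)) → ZMod p) : Prop :=
  ∃ (s : ℕ) (ρ : Fin s → ι) (Φ : List (Atom σ (Sum.elim τ ρ))), ∀ a, F a = numExt 𝓗 Φ a

/-- The `0`-`1`-function of a proposition, with values in `ZMod p`. -/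
noncomputable def ind (p : ℕ) (P : Prop) : ZMod p := if P then 1 else 0

theorem ind_and (p : ℕ) (P Q : Prop) : ind p (P ∧ Q) = ind p P * ind p Q := by
  by_cases hP : P <;> by_cases hQ : Q <;> simp [ind, hP, hQ]

variable [∀ i, Fintype (H i)] {𝓗 : RelStructure σ H} {p : ℕ} {V : Type*} {τ : V → ι}

theorem natCast_card_subtype (p : ℕ) {α : Type*} [Fintype α] (P : α → Prop) :
    ((Nat.card {b // P b} : ℕ) : ZMod p) = ∑ b, ind p (P b) := by
  rw [Nat.card_eq_fintype_card, Fintype.card_subtype, Finset.card_filter]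
  simp [ind]

/-- Assignments to `V ⊕ Y` are pairs of assignments. -/
def joinEquiv {V Y : Type*} (τ : V → ι) (ρ : Y → ι) :
    ((x : V) → H (τ x)) × ((y : Y) → H (ρ y)) ≃ ((x : V ⊕ Y) → H (Sum.elim τ ρ x)) where
  toFun b := joinAssignment b.1 b.2
  invFun s := (fun x => s (.inl x), fun y => s (.inr y))
  left_inv _ := rfl
  right_inv s := by funext x; rcases x with x | y <;> rfl

theorem isDefFun_iff {F : ((x : V) → H (τ x)) → ZMod p} :
    IsDefFun 𝓗 p τ F ↔ ∃ (s : ℕ) (ρ : Fin s → ι) (Φ : List (Atom σ (Sum.elim τ ρ))), ∀ a,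
      F a = ∑ b, ind p (∀ A ∈ Φ, A.Holds 𝓗 (joinAssignment a b)) := by
  simp only [IsDefFun, numExt, natCast_card_subtype]

theorem IsDefFun.of_fintype {Y : Type*} [Fintype Y] [DecidableEq Y] (ρ : Y → ι)
    (Φ : List (Atom σ (Sum.elim τ ρ))) {F : ((x : V) → H (τ x)) → ZMod p}
    (hF : ∀ a, F a = ∑ b, ind p (∀ A ∈ Φ, A.Holds 𝓗 (joinAssignment a b))) :
    IsDefFun 𝓗 p τ F := by
  let e := Fintype.equivFin Y
  let θ : (x : V ⊕ Y) → VarOfSort (Sum.elim τ (ρ ∘ e.symm)) (Sum.elim τ ρ x)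
    | .inl x => ⟨.inl x, rfl⟩
    | .inr y => ⟨.inr (e y), by simp⟩
  refine isDefFun_iff.2 ⟨_, ρ ∘ e.symm, Φ.map (Atom.subst θ), fun a => ?_⟩
  rw [hF]
  refine Fintype.sum_equiv (Equiv.piCongrLeft' (fun y => H (ρ y)) e) _ _ fun b => ?_
  congr 1
  simp only [List.forall_mem_map, Atom.holds_subst]
  have : joinAssignment a b = fun x => (θ x).value
      (joinAssignment a (Equiv.piCongrLeft' (fun y => H (ρ y)) e b)) := by
    funext x
    rcases x with x | y
    · rfl
    · change b y = VarOfSort.value ⟨Sum.inr (e y), _⟩ _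
      have h : ∀ (y' : Y) (h : ρ y' = ρ y), y' = y → b y = (h ▸ b y' : H (ρ y)) := by
        rintro y' h rfl; rfl
      exact h (e.symm (e y)) _ (by simp)
  rw [this]

theorem IsDefFun.subst {V' : Type*} {τ' : V' → ι} {F : ((x : V) → H (τ x)) → ZMod p}
    (hF : IsDefFun 𝓗 p τ F) (θ : (x : V) → VarOfSort τ' (τ x)) :
    IsDefFun 𝓗 p τ' fun a => F fun x => (θ x).value a := by
  obtain ⟨s, ρ, Φ, h⟩ := isDefFun_iff.1 hF
  let θ' : (x : V ⊕ Fin s) → VarOfSort (Sum.elim τ' ρ) (Sum.elim τ ρ x)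
    | .inl x => ⟨.inl (θ x).1, (θ x).2⟩
    | .inr y => ⟨.inr y, rfl⟩
  refine .of_fintype ρ (Φ.map (Atom.subst θ')) fun a => ?_
  rw [h]
  refine Finset.sum_congr rfl fun b _ => ?_
  congr 1
  simp only [List.forall_mem_map, Atom.holds_subst]
  have : joinAssignment (fun x => (θ x).value a) b = fun x => (θ' x).value
      (joinAssignment a b) := by
    funext x
    rcases x with x | y <;> rfl
  rw [this]

/-- Conjoining formulas with disjoint auxiliary variables multiplies the numbers of extensions. -/
theorem IsDefFun.mul {F G : ((x : V) → H (τ x)) → ZMod p}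
    (hF : IsDefFun 𝓗 p τ F) (hG : IsDefFun 𝓗 p τ G) : IsDefFun 𝓗 p τ fun a => F a * G a := by
  obtain ⟨s, ρ, Φ, h⟩ := isDefFun_iff.1 hF
  obtain ⟨s', ρ', Ψ, h'⟩ := isDefFun_iff.1 hG
  let θ : (x : V ⊕ Fin s) → VarOfSort (Sum.elim τ (Sum.elim ρ ρ')) (Sum.elim τ ρ x)
    | .inl x => ⟨.inl x, rfl⟩
    | .inr y => ⟨.inr (.inl y), rfl⟩
  let θ' : (x : V ⊕ Fin s') → VarOfSort (Sum.elim τ (Sum.elim ρ ρ')) (Sum.elim τ ρ' x)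
    | .inl x => ⟨.inl x, rfl⟩
    | .inr y => ⟨.inr (.inr y), rfl⟩
  refine .of_fintype (Sum.elim ρ ρ') (Φ.map (Atom.subst θ) ++ Ψ.map (Atom.subst θ'))
    fun a => ?_
  rw [h, h', Fintype.sum_mul_sum, ← Fintype.sum_prod_type']
  refine Fintype.sum_equiv
    (joinEquiv ρ ρ') _ _ ?_
  intro b
  rw [← ind_and]
  congr 1
  simp only [List.forall_mem_append, List.forall_mem_map, Atom.holds_subst]
  have h₁ : joinAssignment a b.1 = fun x => (θ x).value
      (joinAssignment a (joinAssignment b.1 b.2)) := by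
    funext x
    rcases x with x | y <;> rfl
  have h₂ : joinAssignment a b.2 = fun x => (θ' x).value
      (joinAssignment a (joinAssignment b.1 b.2)) := by
    funext x
    rcases x with x | y <;> rfl
  rw [h₁, h₂]
  rfl

theorem IsDefFun.sum {Y : Type*} [Fintype Y] [DecidableEq Y] {ρ : Y → ι}
    {F : ((x : V ⊕ Y) → H (Sum.elim τ ρ x)) → ZMod p} (hF : IsDefFun 𝓗 p (Sum.elim τ ρ) F) :
    IsDefFun 𝓗 p τ fun a => ∑ b, F (joinAssignment a b) := by
  obtain ⟨s, ρ', Φ, h⟩ := isDefFun_iff.1 hF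
  let θ : (x : (V ⊕ Y) ⊕ Fin s) →
      VarOfSort (Sum.elim τ (Sum.elim ρ ρ')) (Sum.elim (Sum.elim τ ρ) ρ' x)
    | .inl (.inl x) => ⟨.inl x, rfl⟩
    | .inl (.inr y) => ⟨.inr (.inl y), rfl⟩
    | .inr y => ⟨.inr (.inr y), rfl⟩
  refine .of_fintype (Sum.elim ρ ρ') (Φ.map (Atom.subst θ)) fun a => ?_
  simp only [h]
  rw [← Fintype.sum_prod_type']
  refine Fintype.sum_equiv
    (joinEquiv ρ ρ') _ _ ?_
  intro b
  congr 1
  simp only [List.forall_mem_map, Atom.holds_subst]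
  have h₁ : joinAssignment (joinAssignment a b.1) b.2 = fun x => (θ x).value
      (joinAssignment a (joinAssignment b.1 b.2)) := by
    funext x
    rcases x with (x | y) | y <;> rfl
  rw [h₁]
  rfl

theorem IsDefFun.one : IsDefFun 𝓗 p τ fun _ => 1 :=
  .of_fintype (Y := Empty) (fun y => y.elim) [] fun a => by simp [ind]

theorem IsDefFun.prod {κ : Type*} (s : Finset κ) {F : κ → ((x : V) → H (τ x)) → ZMod p}
    (hF : ∀ k ∈ s, IsDefFun 𝓗 p τ (F k)) : IsDefFun 𝓗 p τ fun a => ∏ k ∈ s, F k a := by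
  induction s using Finset.induction_on with
  | empty => simpa using IsDefFun.one
  | insert k s hk ih =>
    simp only [Finset.prod_insert hk]
    exact (hF _ (by simp)).mul (ih fun j hj => hF _ (by simp [hj]))

theorem IsDefFun.pow {F : ((x : V) → H (τ x)) → ZMod p} (hF : IsDefFun 𝓗 p τ F) (n : ℕ) :
    IsDefFun 𝓗 p τ fun a => F a ^ n := by
  simpa using IsDefFun.prod (Finset.range n) (F := fun _ => F) fun _ _ => hF

theorem IsDefFun.rel (r : σ.Symbol) :
    IsDefFun 𝓗 p (σ.type r) fun a => ind p (a ∈ 𝓗.rel r) :=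
  .of_fintype (Y := Empty) (fun y => y.elim) [.rel r fun q => ⟨.inl q, rfl⟩] fun a => by
    simp [Atom.Holds, joinAssignment, VarOfSort.value]

theorem mppDefinable_iff {R : Set ((x : V) → H (τ x))} :
    MppDefinable 𝓗 p τ R ↔ ∃ F, IsDefFun 𝓗 p τ F ∧ ∀ a, a ∈ R ↔ F a ≠ 0 := by
  have h : ∀ n : ℕ, n ≡ 0 [MOD p] ↔ (n : ZMod p) = 0 := fun n => by
    rw [Nat.modEq_zero_iff_dvd, ZMod.natCast_eq_zero_iff]
  constructor
  · rintro ⟨s, ρ, Φ, hR⟩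
    exact ⟨_, ⟨s, ρ, Φ, fun _ => rfl⟩, fun a => by rw [hR, h]⟩
  · rintro ⟨F, ⟨s, ρ, Φ, hF⟩, hR⟩
    exact ⟨s, ρ, Φ, fun a => by rw [hR, hF, ne_eq, h]⟩

theorem pow_card_sub_one_eq_ind (hp : p.Prime) (c : ZMod p) : c ^ (p - 1) = ind p (c ≠ 0) := by
  have := Fact.mk hp
  by_cases h : c = 0
  · simp [h, ind, Nat.sub_eq_zero_iff_le, hp.one_lt]
  · simp [h, ind, ZMod.pow_card_sub_one_eq_one h]

/-- By Fermat, the power `p - 1` normalises all nonzero counts to 1. -/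
theorem IsDefFun.ind_ne_zero (hp : p.Prime) {F : ((x : V) → H (τ x)) → ZMod p}
    (hF : IsDefFun 𝓗 p τ F) : IsDefFun 𝓗 p τ fun a => ind p (F a ≠ 0) := by
  simpa only [pow_card_sub_one_eq_ind hp] using hF.pow (p - 1)

theorem MppDefinable.isDefFun (hp : p.Prime) {R : Set ((x : V) → H (τ x))}
    (hR : MppDefinable 𝓗 p τ R) : IsDefFun 𝓗 p τ fun a => ind p (a ∈ R) := by
  obtain ⟨F, hF, h⟩ := mppDefinable_iff.1 hR
  simpa only [h] using hF.ind_ne_zero hp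

theorem IsConservative.isDefFun (h𝓗 : IsConservative 𝓗 p) (hp : p.Prime) {i : ι}
    (x : VarOfSort τ i) (A : Set (H i)) :
    IsDefFun 𝓗 p τ fun a => ind p (x.value a ∈ A) :=
  ((h𝓗 i A).isDefFun hp).subst fun _ => x

/-- The variable `y` is kept as a dummy on which the sum does not depend, so that eliminations can
be iterated over a fixed variable set. -/
theorem IsDefFun.sum_update {F : ((x : V) → H (τ x)) → ZMod p} (hF : IsDefFun 𝓗 p τ F) (y : V) :
    IsDefFun 𝓗 p τ fun a => ∑ z, F (Function.update a y z) := by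
  let θ : (x : V) → VarOfSort (Sum.elim τ fun _ : Unit => τ y) (τ x) := fun x =>
    if h : x = y then ⟨.inr (), by simp [h]⟩ else ⟨.inl x, rfl⟩
  convert (hF.subst θ).sum using 2 with a
  refine Fintype.sum_equiv (Equiv.funUnique Unit (H (τ y))).symm _ _ ?_
  intro z
  congr 1
  funext x
  by_cases h : x = y
  · subst h
    rw [Function.update_self, show θ x = ⟨.inr (), rfl⟩ from dif_pos rfl]
    rfl
  · rw [Function.update_of_ne h, show θ x = ⟨.inl x, rfl⟩ from dif_neg h]
    rfl

/-- Substitution of variables and constants. -/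
theorem IsDefFun.specialize [Fintype V] [DecidableEq V] (h𝓗 : IsConservative 𝓗 p) (hp : p.Prime)
    {V' : Type*} {τ' : V' → ι} {F : ((x : V) → H (τ x)) → ZMod p} (hF : IsDefFun 𝓗 p τ F)
    (θ : (x : V) → VarOfSort τ' (τ x) ⊕ H (τ x)) :
    IsDefFun 𝓗 p τ' fun a => F fun x => Sum.elim (fun v => v.value a) id (θ x) := by
  let θ' : (x : V) → VarOfSort (Sum.elim τ' τ) (τ x) := fun x =>
    Sum.elim (fun v => ⟨.inl v.1, v.2⟩) (fun _ => ⟨.inr x, rfl⟩) (θ x)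
  by_cases hne : Nonempty ((x : V) → H (τ x))
  -- Every variable gets an auxiliary copy, pinned to `c` by a singleton constraint; the copies
  -- replaced by variables are pinned to the arbitrary value `c₀`, so that exactly one term of the
  -- sum survives.
  · obtain ⟨c₀⟩ := hne
    let c : (x : V) → H (τ x) := fun x => Sum.elim (fun _ => c₀ x) id (θ x)
    convert ((hF.subst θ').mul (IsDefFun.prod Finset.univ
      (F := fun x a => ind p (VarOfSort.value ⟨Sum.inr x, rfl⟩ a ∈ ({c x} : Set (H (τ x)))))
      fun x _ => h𝓗.isDefFun hp _ _)).sum using 2 with a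
    rw [Finset.sum_eq_single c]
    · have : ∀ x, Sum.elim (fun v => VarOfSort.value v a) id (θ x)
          = (θ' x).value (joinAssignment a c) := fun x => by
        have hc : c x = Sum.elim (fun _ => c₀ x) id (θ x) := rfl
        have hθ : θ' x = Sum.elim (fun v => ⟨.inl v.1, v.2⟩) (fun _ => ⟨.inr x, rfl⟩) (θ x) := rfl
        rw [hθ]
        rcases h : θ x with v | d
        · rfl
        · rw [h] at hc
          exact hc.symm
      simp only [this]
      rw [Finset.prod_eq_one, mul_one]
      intro x _
      exact if_pos rfl
    · intro b _ hb
      obtain ⟨x, hx⟩ := Function.ne_iff.1 hb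
      rw [Finset.prod_eq_zero (Finset.mem_univ x), mul_zero]
      exact if_neg hx
    · simp
  · have hemp : ∀ a : (x : V') → H (τ' x), False := fun a =>
      hne ⟨fun x => Sum.elim (fun v => v.value a) id (θ x)⟩
    convert IsDefFun.one (𝓗 := 𝓗) (p := p) (τ := τ') using 2 with a
    exact (hemp a).elim

end Calculus

/-! ### Definable matrices and their 2×2 blocks. -/

section BinaryFunctions

variable {ι : Type u} {H : ι → Type w} {σ : Signature.{u, v} ι} [∀ i, Fintype (H i)]
  {𝓗 : RelStructure σ H} {p : ℕ} {i j : ι}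

/-- Definability of a binary function, regarded as a matrix. -/
def IsDefMat (𝓗 : RelStructure σ H) (p : ℕ) {i j : ι} (M : H i → H j → ZMod p) : Prop :=
  IsDefFun 𝓗 p (Sum.elim (fun _ : Unit => i) (fun _ : Unit => j))
    fun a => M (a (.inl ())) (a (.inr ()))

theorem IsDefMat.isDefFun {M : H i → H j → ZMod p} (hM : IsDefMat 𝓗 p M) {V : Type*} {τ : V → ι}
    (x : VarOfSort τ i) (y : VarOfSort τ j) :
    IsDefFun 𝓗 p τ fun a => M (x.value a) (y.value a) :=
  IsDefFun.subst hM fun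
    | .inl _ => x
    | .inr _ => y

theorem IsDefFun.isDefMat (h𝓗 : IsConservative 𝓗 p) (hp : p.Prime) {V : Type*} [Fintype V]
    {τ : V → ι} {F : ((x : V) → H (τ x)) → ZMod p} (hF : IsDefFun 𝓗 p τ F) {s y : V} (hsy : s ≠ y)
    (a : (x : V) → H (τ x)) :
    IsDefMat 𝓗 p fun c d => F (Function.update (Function.update a s c) y d) := by
  let θ : (x : V) → VarOfSort (Sum.elim (fun _ : Unit => τ s) (fun _ : Unit => τ y)) (τ x) ⊕
      H (τ x) := fun x =>
    if h : x = y then .inl ⟨.inr (), by simp [h]⟩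
    else if h : x = s then .inl ⟨.inl (), by simp [h]⟩ else .inr (a x)
  unfold IsDefMat
  convert hF.specialize h𝓗 hp θ using 3 with b
  funext x
  by_cases h : x = y
  · subst h
    rw [show θ x = .inl ⟨.inr (), rfl⟩ from dif_pos rfl]
    exact Function.update_self x _ _
  · refine (Function.update_of_ne h _ _).trans ?_
    by_cases h' : x = s
    · subst h'
      rw [show θ x = .inl ⟨.inl (), rfl⟩ from (dif_neg h).trans (dif_pos rfl)]
      exact Function.update_self x _ _
    · rw [show θ x = .inr (a x) from (dif_neg h).trans (dif_neg h')]
      exact Function.update_of_ne h' _ _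

theorem IsDefMat.hadamard {M N : H i → H j → ZMod p} (hM : IsDefMat 𝓗 p M)
    (hN : IsDefMat 𝓗 p N) : IsDefMat 𝓗 p fun c d => M c d * N c d :=
  IsDefFun.mul hM hN

/-- This is the product of `A`, the transpose of `B`, and `C`: rows and columns have different
sorts, so a product of two such matrices would not be of the same kind. -/
theorem IsDefMat.triple {A B C : H i → H j → ZMod p} (hA : IsDefMat 𝓗 p A)
    (hB : IsDefMat 𝓗 p B) (hC : IsDefMat 𝓗 p C) :
    IsDefMat 𝓗 p fun c d => ∑ c', ∑ d', A c d' * B c' d' * C c' d := by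
  have h := IsDefFun.sum (((hA.isDefFun
    (τ := Sum.elim (Sum.elim (fun _ : Unit => i) (fun _ : Unit => j))
      (Sum.elim (fun _ : Unit => i) (fun _ : Unit => j)))
    ⟨.inl (.inl ()), rfl⟩ ⟨.inr (.inr ()), rfl⟩).mul (hB.isDefFun
    ⟨.inr (.inl ()), rfl⟩ ⟨.inr (.inr ()), rfl⟩)).mul (hC.isDefFun
    ⟨.inr (.inl ()), rfl⟩ ⟨.inl (.inr ()), rfl⟩))
  unfold IsDefMat
  convert h using 2 with a
  refine (Fintype.sum_prod_type' fun c' d' =>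
    A (a (.inl ())) d' * B c' d' * C c' (a (.inr ()))).symm.trans ?_
  refine Fintype.sum_equiv (((Equiv.funUnique Unit (H i)).symm.prodCongr
    (Equiv.funUnique Unit (H j)).symm).trans (joinEquiv _ _)) _ _ ?_
  intro b
  rfl

theorem IsDefMat.restrict (h𝓗 : IsConservative 𝓗 p) (hp : p.Prime) {M : H i → H j → ZMod p}
    (hM : IsDefMat 𝓗 p M) (A : Set (H i)) (B : Set (H j)) :
    IsDefMat 𝓗 p fun c d => ind p (c ∈ A) * ind p (d ∈ B) * M c d := by
  have hA := h𝓗.isDefFun hp (τ := Sum.elim (fun _ : Unit => i) fun _ : Unit => j) (i := i)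
    ⟨.inl (), rfl⟩ A
  have hB := h𝓗.isDefFun hp (τ := Sum.elim (fun _ : Unit => i) fun _ : Unit => j) (i := j)
    ⟨.inr (), rfl⟩ B
  exact (hA.mul hB).mul hM

/-- `N` is a block, with rows `u` and columns `v`, of a definable matrix vanishing elsewhere. -/
def IsDefBlock (𝓗 : RelStructure σ H) {p : ℕ} (u : Fin 2 → H i) (v : Fin 2 → H j)
    (N : Matrix (Fin 2) (Fin 2) (ZMod p)) : Prop :=
  ∃ M : H i → H j → ZMod p, IsDefMat 𝓗 p M ∧
    (∀ c d, M c d ≠ 0 → c ∈ Set.range u ∧ d ∈ Set.range v) ∧ ∀ k l, M (u k) (v l) = N k l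

variable {u : Fin 2 → H i} {v : Fin 2 → H j}

theorem IsDefMat.isDefBlock (h𝓗 : IsConservative 𝓗 p) (hp : p.Prime) {M : H i → H j → ZMod p}
    (hM : IsDefMat 𝓗 p M) (u : Fin 2 → H i) (v : Fin 2 → H j) :
    IsDefBlock 𝓗 u v (.of fun k l => M (u k) (v l)) := by
  refine ⟨_, hM.restrict h𝓗 hp (Set.range u) (Set.range v), fun c d h => ?_, fun k l => ?_⟩
  · by_contra h'
    rw [not_and_or] at h'
    rcases h' with h' | h' <;> simp [ind, h'] at h
  · simp [ind]

theorem IsDefBlock.hadamard {A B : Matrix (Fin 2) (Fin 2) (ZMod p)}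
    (hA : IsDefBlock 𝓗 u v A) (hB : IsDefBlock 𝓗 u v B) :
    IsDefBlock 𝓗 u v (.of fun k l => A k l * B k l) := by
  obtain ⟨M, hM, hM₁, hM₂⟩ := hA
  obtain ⟨N, hN, hN₁, hN₂⟩ := hB
  exact ⟨_, hM.hadamard hN, fun c d h => hM₁ c d (left_ne_zero_of_mul h),
    fun k l => by rw [hM₂, hN₂]; rfl⟩

theorem IsDefBlock.triple (hu : u.Injective) (hv : v.Injective)
    {A B C : Matrix (Fin 2) (Fin 2) (ZMod p)} (hA : IsDefBlock 𝓗 u v A)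
    (hB : IsDefBlock 𝓗 u v B) (hC : IsDefBlock 𝓗 u v C) :
    IsDefBlock 𝓗 u v (A * B.transpose * C) := by
  obtain ⟨M, hM, hM₁, hM₂⟩ := hA
  obtain ⟨N, hN, hN₁, hN₂⟩ := hB
  obtain ⟨P, hP, hP₁, hP₂⟩ := hC
  refine ⟨_, hM.triple hN hP, fun c d h => ?_, fun k l => ?_⟩
  · obtain ⟨c', -, h⟩ := Finset.exists_ne_zero_of_sum_ne_zero h
    obtain ⟨d', -, h⟩ := Finset.exists_ne_zero_of_sum_ne_zero h
    exact ⟨(hM₁ _ _ (left_ne_zero_of_mul (left_ne_zero_of_mul h))).1,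
      (hP₁ _ _ (right_ne_zero_of_mul h)).2⟩
  · simp only [Matrix.mul_apply, Finset.sum_mul, Matrix.transpose_apply]
    symm
    refine Fintype.sum_of_injective u hu _ _ (fun c' hc' => ?_) fun k' => ?_
    · refine Finset.sum_eq_zero fun d' _ => ?_
      rw [show P c' (v l) = 0 from by_contra fun h => hc' (hP₁ _ _ h).1, mul_zero]
    · refine Fintype.sum_of_injective v hv _ _ (fun d' hd' => ?_) fun l' => ?_
      · rw [show M (u k) d' = 0 from by_contra fun h => hd' (hM₁ _ _ h).2, zero_mul, zero_mul]
      · rw [hM₂, hN₂, hP₂]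

/-- Turns a block with first row (1, 1) and unequal second row into weights that select one chosen
column in the first row and both columns in the second. -/
theorem IsDefBlock.of_row (hu : u.Injective) (hv : v.Injective)
    {N : Matrix (Fin 2) (Fin 2) (ZMod 2)} (hN : IsDefBlock 𝓗 u v N) (h₀ : N 0 0 = 1)
    (h₁ : N 0 1 = 1) (h : N 1 0 ≠ N 1 1) :
    IsDefBlock 𝓗 u v (p := 2) !![1, 0; 1, 1] ∧ IsDefBlock 𝓗 u v (p := 2) !![0, 1; 1, 1] := by
  have cases : ∀ c d : ZMod 2, c ≠ d → c = 1 ∧ d = 0 ∨ c = 0 ∧ d = 1 := by decide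
  rcases cases _ _ h with ⟨h₂, h₃⟩ | ⟨h₂, h₃⟩
  · have hQ : IsDefBlock 𝓗 u v (p := 2) !![1, 1; 1, 0] := by
      convert hN
      ext k l
      fin_cases k <;> fin_cases l <;> simp [h₀, h₁, h₂, h₃]
    -- This symmetric matrix has order 3 over the field with two elements. Once the identity is
    -- available, `triple` also yields products of two factors.
    have hI : IsDefBlock 𝓗 u v (p := 2) !![1, 0; 0, 1] := by
      convert hQ.triple hu hv hQ hQ using 1
      decide
    have hT : IsDefBlock 𝓗 u v (p := 2) !![0, 1; 1, 1] := by
      convert hQ.triple hu hv hQ hI using 1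
      decide
    have hX : IsDefBlock 𝓗 u v (p := 2) !![0, 1; 1, 0] := by
      convert hQ.hadamard hT using 1
      decide
    refine ⟨?_, hT⟩
    convert hX.triple hu hv hI hQ using 1
    decide
  · have hQ : IsDefBlock 𝓗 u v (p := 2) !![1, 1; 0, 1] := by
      convert hN
      ext k l
      fin_cases k <;> fin_cases l <;> simp [h₀, h₁, h₂, h₃]
    have hX : IsDefBlock 𝓗 u v (p := 2) !![0, 1; 1, 0] := by
      convert hQ.triple hu hv hQ hQ using 1
      decide
    have hT : IsDefBlock 𝓗 u v (p := 2) !![1, 0; 1, 1] := by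
      convert hQ.triple hu hv hQ hX using 1
      decide
    have hI : IsDefBlock 𝓗 u v (p := 2) !![1, 0; 0, 1] := by
      convert hQ.hadamard hT using 1
      decide
    refine ⟨hT, ?_⟩
    convert hT.triple hu hv hI hX using 1
    decide

end BinaryFunctions

/-! ### Modular elimination of variables. -/

section Elimination

variable {ι : Type u} {H : ι → Type w} {σ : Signature.{u, v} ι} [∀ i, Fintype (H i)]
  {𝓗 : RelStructure σ H} {p : ℕ} {V : Type*} [Fintype V] {τ : V → ι}

theorem sum_ind_singleton {α : Type*} [Fintype α] (g : α → ZMod p) (c : α) :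
    ∑ z, ind p (z ∈ ({c} : Set α)) * g z = g c := by
  simp [ind]

theorem sum_ind_pair {α : Type*} [Fintype α] (g : α → ZMod p) {c d : α} (h : c ≠ d) :
    ∑ z, ind p (z ∈ ({c, d} : Set α)) * g z = g c + g d := by
  rw [Fintype.sum_eq_add c d h]
  · simp [ind]
  · rintro z ⟨h₁, h₂⟩
    simp [ind, h₁, h₂]

theorem IsDefFun.sum_update_ind (h𝓗 : IsConservative 𝓗 p) (hp : p.Prime)
    {F : ((x : V) → H (τ x)) → ZMod p} (hF : IsDefFun 𝓗 p τ F) (y : V) (B : Set (H (τ y))) :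
    IsDefFun 𝓗 p τ fun a => ∑ z, ind p (z ∈ B) * F (Function.update a y z) := by
  convert ((h𝓗.isDefFun hp ⟨y, rfl⟩ B).mul hF).sum_update y using 5 with a z
  exact iff_of_eq (congrArg (· ∈ B) (Function.update_self y z a).symm)

/-- A definable function separating the values `e`, `f` at `y` in one row but not in another one
depends in the same way on some pair of coordinates. -/
theorem exists_isDefMat_row (h𝓗 : IsConservative 𝓗 2) {y : V} {e f : H (τ y)} (D : Finset V)
    (hD : y ∉ D) {F : ((x : V) → H (τ x)) → ZMod 2} (hF : IsDefFun 𝓗 2 τ F)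
    {x x' : (x : V) → H (τ x)} (hx : ∀ s ∉ D, s ≠ y → x s = x' s)
    (he : F (Function.update x y e) = 1) (hf : F (Function.update x y f) = 1)
    (hne : F (Function.update x' y e) ≠ F (Function.update x' y f)) :
    ∃ s ∈ D, x s ≠ x' s ∧ ∃ M : H (τ s) → H (τ y) → ZMod 2, IsDefMat 𝓗 2 M ∧
      M (x s) e = 1 ∧ M (x s) f = 1 ∧ M (x' s) e ≠ M (x' s) f := by
  induction D using Finset.induction_on generalizing F x x' with
  | empty =>
    exfalso
    have h : ∀ z, Function.update x y z = Function.update x' y z := fun z => by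
      funext s
      by_cases hs : s = y
      · subst hs; simp
      · simp [hs, hx s (by simp) hs]
    rw [← h, ← h, he, hf] at hne
    exact hne rfl
  | insert s D hs ih =>
    have hsy : s ≠ y := fun h => hD (by simp [h])
    have hyD : y ∉ D := fun h => hD (by simp [h])
    by_cases hxs : x s = x' s
    · obtain ⟨t, ht, h⟩ := ih hyD hF (x := x) (x' := x') (fun t ht hty => by
        by_cases hts : t = s
        · rw [hts, hxs]
        · exact hx t (by simp [ht, hts]) hty) he hf hne
      exact ⟨t, by simp [ht], h⟩
    have hcases : ∀ c d : ZMod 2, c ≠ d ∨ c = 1 ∧ d = 1 ∨ c = 0 ∧ d = 0 := by decide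
    have left : ∀ {F' : ((x : V) → H (τ x)) → ZMod 2}, IsDefFun 𝓗 2 τ F' →
        F' (Function.update (Function.update x s (x' s)) y e) = 1 →
        F' (Function.update (Function.update x s (x' s)) y f) = 1 →
        F' (Function.update x' y e) ≠ F' (Function.update x' y f) →
        ∃ t ∈ insert s D, x t ≠ x' t ∧ ∃ M : H (τ t) → H (τ y) → ZMod 2, IsDefMat 𝓗 2 M ∧
          M (x t) e = 1 ∧ M (x t) f = 1 ∧ M (x' t) e ≠ M (x' t) f := by
      intro F' hF' h₁ h₂ h₃
      obtain ⟨t, ht, h⟩ := ih hyD hF' (fun t ht hty => by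
        by_cases hts : t = s
        · subst hts; simp
        · rw [Function.update_of_ne hts]
          exact hx t (by simp [ht, hts]) hty) h₁ h₂ h₃
      have hts : t ≠ s := fun h => hs (h ▸ ht)
      rw [Function.update_of_ne hts] at h
      exact ⟨t, by simp [ht], h⟩
    have right : ∀ {F' : ((x : V) → H (τ x)) → ZMod 2}, IsDefFun 𝓗 2 τ F' →
        F' (Function.update x y e) = 1 → F' (Function.update x y f) = 1 →
        F' (Function.update (Function.update x' s (x s)) y e) ≠
          F' (Function.update (Function.update x' s (x s)) y f) →
        ∃ t ∈ insert s D, x t ≠ x' t ∧ ∃ M : H (τ t) → H (τ y) → ZMod 2, IsDefMat 𝓗 2 M ∧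
          M (x t) e = 1 ∧ M (x t) f = 1 ∧ M (x' t) e ≠ M (x' t) f := by
      intro F' hF' h₁ h₂ h₃
      obtain ⟨t, ht, h⟩ := ih hyD hF' (fun t ht hty => by
        by_cases hts : t = s
        · subst hts; simp
        · rw [Function.update_of_ne hts]
          exact hx t (by simp [ht, hts]) hty) h₁ h₂ h₃
      have hts : t ≠ s := fun h => hs (h ▸ ht)
      rw [Function.update_of_ne hts] at h
      exact ⟨t, by simp [ht], h⟩
    -- Move `x` one coordinate towards `x'`. Unequal values at `e`, `f` give the matrix at `s`
    -- directly, values (1, 1) allow induction from the moved point, and values (0, 0) require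
    -- moving `x'` towards `x` instead.
    rcases hcases (F (Function.update (Function.update x s (x' s)) y e))
      (F (Function.update (Function.update x s (x' s)) y f)) with h | ⟨h₁, h₂⟩ | ⟨h₁, h₂⟩
    · exact ⟨s, by simp, hxs, _, hF.isDefMat h𝓗 Nat.prime_two hsy x, by simpa using he,
        by simpa using hf, h⟩
    · exact left hF h₁ h₂ hne
    rcases hcases (F (Function.update (Function.update x' s (x s)) y e))
      (F (Function.update (Function.update x' s (x s)) y f)) with h | ⟨h₃, h₄⟩ | ⟨h₃, h₄⟩
    · exact right hF he hf h
    · exact ⟨s, by simp, hxs, _, hF.isDefMat h𝓗 Nat.prime_two hsy x', h₃, h₄, by simpa using hne⟩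
    -- Both mixed points have the values (0, 0). Summing over the two values at `s` then preserves
    -- the values at `x` and `x'` and makes the function independent of `s`.
    · have key : ∀ (a : (x : V) → H (τ x)) (z : H (τ y)),
          ∑ c, ind 2 (c ∈ ({x s, x' s} : Set (H (τ s)))) *
            F (Function.update (Function.update a y z) s c) =
          F (Function.update (Function.update a s (x s)) y z) +
            F (Function.update (Function.update a s (x' s)) y z) := fun a z => by
        rw [sum_ind_pair _ hxs, Function.update_comm hsy.symm, Function.update_comm hsy.symm]
      refine right (hF.sum_update_ind h𝓗 Nat.prime_two s {x s, x' s}) ?_ ?_ ?_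
      · rw [key, h₁, Function.update_eq_self, he, add_zero]
      · rw [key, h₂, Function.update_eq_self, hf, add_zero]
      · rw [key, key]
        simpa only [Function.update_idem, h₃, h₄, Function.update_eq_self, zero_add] using hne

/-- At `(e, f)` the three tuples have the values (1, 1), (1, 0), (0, 1), and no restriction of `y`
alone makes all sums odd over these two values. A coordinate `s` separating `x i` from `x j` allows
one column to be selected for `x i` and both for `x j`. -/
theorem exists_weight_of_trouble (h𝓗 : IsConservative 𝓗 2) {F : ((x : V) → H (τ x)) → ZMod 2}
    (hF : IsDefFun 𝓗 2 τ F) {x : Fin 3 → (x : V) → H (τ x)}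
    (hx : ∀ s, ∃ i j, i ≠ j ∧ x i s = x j s) {y : V} {e f : H (τ y)} (hef : e ≠ f)
    {i j k : Fin 3} (hall : ∀ l, l = i ∨ l = j ∨ l = k)
    (hie : F (Function.update (x i) y e) = 1) (hif : F (Function.update (x i) y f) = 1)
    (hje : F (Function.update (x j) y e) = 1) (hjf : F (Function.update (x j) y f) = 0)
    (hke : F (Function.update (x k) y e) = 0) (hkf : F (Function.update (x k) y f) = 1) :
    ∃ G : ((x : V) → H (τ x)) → ZMod 2, IsDefFun 𝓗 2 τ G ∧
      ∀ l, ∑ z, G (Function.update (x l) y z) * F (Function.update (x l) y z) ≠ 0 := by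
  obtain ⟨s, hs, hxs, M, hM, hM₁, hM₂, hM₃⟩ := exists_isDefMat_row h𝓗 (Finset.univ.erase y)
    (by simp) hF (x := x i) (x' := x j) (fun s hs hsy => by simp [hsy] at hs) hie hif
    (by rw [hje, hjf]; exact one_ne_zero)
  have hsy : s ≠ y := by simpa using hs
  have hu : Function.Injective ![x i s, x j s] := by
    simpa [Function.Injective, Fin.forall_fin_two, hxs] using Ne.symm hxs
  have hv : Function.Injective ![e, f] := by
    simpa [Function.Injective, Fin.forall_fin_two, hef] using hef.symm
  obtain ⟨h₁, h₂⟩ := (hM.isDefBlock h𝓗 Nat.prime_two ![x i s, x j s] ![e, f]).of_row hu hv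
    (by simpa using hM₁) (by simpa using hM₂) (by simpa using hM₃)
  have key : ∀ {T : H (τ s) → H (τ y) → ZMod 2}, (∀ c d, T c d ≠ 0 → c ∈ Set.range
      ![x i s, x j s] ∧ d ∈ Set.range ![e, f]) → ∀ l,
      ∑ z, T (Function.update (x l) y z s) (Function.update (x l) y z y) *
        F (Function.update (x l) y z) =
      T (x l s) e * F (Function.update (x l) y e) +
        T (x l s) f * F (Function.update (x l) y f) := by
    intro T hT l
    rw [Fintype.sum_eq_add e f hef]
    · simp [hsy]
    · rintro z ⟨hz₁, hz₂⟩
      rw [Function.update_self, show T _ z = 0 from by_contra fun h => by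
        obtain ⟨m, hm⟩ := (hT _ _ h).2
        fin_cases m
        · exact hz₁ hm.symm
        · exact hz₂ hm.symm, zero_mul]
  -- Since only two values occur at `s`, the tuple `x k` uses one of the two rows. With the row of
  -- `x j` both columns count; with the row of `x i` the selected column must be `f`.
  have hk : x k s = x j s ∨ x k s = x i s := by
    obtain ⟨m, n, hmn, h⟩ := hx s
    rcases hall m with rfl | rfl | rfl <;> rcases hall n with rfl | rfl | rfl <;>
      simp_all
  rcases hk with hk | hk
  · obtain ⟨T, hT, hT₁, hT₂⟩ := h₁
    refine ⟨_, hT.isDefFun ⟨s, rfl⟩ ⟨y, rfl⟩, fun l => ?_⟩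
    refine (key hT₁ l).trans_ne ?_
    have t₀ := hT₂ 0 0
    have t₁ := hT₂ 0 1
    have t₂ := hT₂ 1 0
    have t₃ := hT₂ 1 1
    simp only [Matrix.cons_val_zero, Matrix.cons_val_one, Matrix.of_apply] at t₀ t₁ t₂ t₃
    rcases hall l with rfl | rfl | rfl
    · simp [t₀, t₁, hie, hif]
    · simp [t₂, t₃, hje, hjf]
    · simp [hk, t₂, t₃, hke, hkf]
  · obtain ⟨T, hT, hT₁, hT₂⟩ := h₂
    refine ⟨_, hT.isDefFun ⟨s, rfl⟩ ⟨y, rfl⟩, fun l => ?_⟩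
    refine (key hT₁ l).trans_ne ?_
    have t₀ := hT₂ 0 0
    have t₁ := hT₂ 0 1
    have t₂ := hT₂ 1 0
    have t₃ := hT₂ 1 1
    simp only [Matrix.cons_val_zero, Matrix.cons_val_one, Matrix.of_apply] at t₀ t₁ t₂ t₃
    rcases hall l with rfl | rfl | rfl
    · simp [t₀, t₁, hie, hif]
    · simp [t₂, t₃, hje, hjf]
    · simp [hk, t₀, t₁, hke, hkf]

/-- If three assignments take at most two values at each variable, then a variable can be summed
out of a definable function not vanishing at them, after multiplication by a definable weight. -/
theorem exists_weight (h𝓗 : IsConservative 𝓗 p) (hp : p.Prime)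
    {F : ((x : V) → H (τ x)) → ZMod p} (hF : IsDefFun 𝓗 p τ F) (hF01 : ∀ a, F a = 0 ∨ F a = 1)
    {x : Fin 3 → (x : V) → H (τ x)} (hFx : ∀ i, F (x i) = 1)
    (hx : ∀ s, ∃ i j, i ≠ j ∧ x i s = x j s) (y : V) :
    ∃ G : ((x : V) → H (τ x)) → ZMod p, IsDefFun 𝓗 p τ G ∧
      ∀ l, ∑ z, G (Function.update (x l) y z) * F (Function.update (x l) y z) ≠ 0 := by
  have := Fact.mk hp
  have third : ∀ i j : Fin 3, i ≠ j → ∃ k, ∀ l, l = i ∨ l = j ∨ l = k := by decide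
  obtain ⟨i, j, hij, hxij⟩ := hx y
  obtain ⟨k, hall⟩ := third i j hij
  set e := x i y with he
  set f := x k y with hf
  have hie : F (Function.update (x i) y e) = 1 := by simp [he, hFx]
  have hje : F (Function.update (x j) y e) = 1 := by simp [hxij, hFx]
  have hkf : F (Function.update (x k) y f) = 1 := by simp [hf, hFx]
  have weight : ∀ B : Set (H (τ y)),
      (∀ l, ∑ z, ind p (z ∈ B) * F (Function.update (x l) y z) ≠ 0) →
      ∃ G : ((x : V) → H (τ x)) → ZMod p, IsDefFun 𝓗 p τ G ∧
        ∀ l, ∑ z, G (Function.update (x l) y z) * F (Function.update (x l) y z) ≠ 0 := by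
    intro B hB
    refine ⟨_, h𝓗.isDefFun hp ⟨y, rfl⟩ B, fun l => ?_⟩
    convert hB l using 5 with z
    exact Function.update_self y z (x l)
  rcases hF01 (Function.update (x k) y e) with hke | hke
  swap
  · refine weight {e} fun l => ?_
    rw [sum_ind_singleton]
    rcases hall l with rfl | rfl | rfl
    · rw [hie]; exact one_ne_zero
    · rw [hje]; exact one_ne_zero
    · rw [hke]; exact one_ne_zero
  have hef : e ≠ f := fun h => by simp [h, hkf] at hke
  -- The values at `(e, f)` are now (1, ?), (1, ?) and (0, 1). Two zeros call for summing over `{e,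
  -- f}`, two ones for fixing `f`. In the mixed cases one sum over `{e, f}` is 2, which vanishes
  -- only for `p = 2`.
  rcases hF01 (Function.update (x i) y f) with hif | hif <;>
    rcases hF01 (Function.update (x j) y f) with hjf | hjf
  · refine weight {e, f} fun l => ?_
    rw [sum_ind_pair _ hef]
    rcases hall l with rfl | rfl | rfl
    · simp [hie, hif]
    · simp [hje, hjf]
    · simp [hke, hkf]
  · by_cases h2 : p = 2
    · subst h2
      exact exists_weight_of_trouble h𝓗 hF hx hef
        (fun l => (or_left_comm.1 (hall l))) hje hjf hie hif hke hkf
    · refine weight {e, f} fun l => ?_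
      rw [sum_ind_pair _ hef]
      rcases hall l with rfl | rfl | rfl
      · simp [hie, hif]
      · rw [hje, hjf, one_add_one_eq_two]
        exact Ring.two_ne_zero (by rwa [ZMod.ringChar_zmod_n])
      · simp [hke, hkf]
  · by_cases h2 : p = 2
    · subst h2
      exact exists_weight_of_trouble h𝓗 hF hx hef hall hie hif hje hjf hke hkf
    · refine weight {e, f} fun l => ?_
      rw [sum_ind_pair _ hef]
      rcases hall l with rfl | rfl | rfl
      · rw [hie, hif, one_add_one_eq_two]
        exact Ring.two_ne_zero (by rwa [ZMod.ringChar_zmod_n])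
      · simp [hje, hjf]
      · simp [hke, hkf]
  · refine weight {f} fun l => ?_
    rw [sum_ind_singleton]
    rcases hall l with rfl | rfl | rfl
    · rw [hif]; exact one_ne_zero
    · rw [hjf]; exact one_ne_zero
    · rw [hkf]; exact one_ne_zero

/-- Variables are summed out one by one with the weights of `exists_weight`. After each sum the
dummy value can be reset to `c`, so the tuples remain two-valued. -/
theorem exists_eliminate_of_twoValued (h𝓗 : IsConservative 𝓗 p) (hp : p.Prime)
    (c : (x : V) → H (τ x)) (W : Finset V) {F : ((x : V) → H (τ x)) → ZMod p}
    (hF : IsDefFun 𝓗 p τ F) {x : Fin 3 → (x : V) → H (τ x)} (hFx : ∀ i, F (x i) ≠ 0)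
    (hx : ∀ s, ∃ i j, i ≠ j ∧ x i s = x j s) :
    ∃ F' : ((x : V) → H (τ x)) → ZMod p, IsDefFun 𝓗 p τ F' ∧
      (∀ i, F' (fun s => if s ∈ W then c s else x i s) ≠ 0) ∧
      ∀ a, F' a ≠ 0 → ∃ b, (∀ s ∉ W, b s = a s) ∧ F b ≠ 0 := by
  induction W using Finset.induction_on generalizing F x with
  | empty => exact ⟨F, hF, by simpa using hFx, fun a ha => ⟨a, fun _ _ => rfl, ha⟩⟩
  | insert y W hy ih =>
    have := Fact.mk hp
    obtain ⟨G, hG, hGx⟩ := exists_weight h𝓗 hp (hF.ind_ne_zero hp)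
      (fun a => by by_cases h : F a = 0 <;> simp [ind, h]) (fun i => if_pos (hFx i)) hx y
    obtain ⟨F', hF', hFx', hFF'⟩ := ih ((hG.mul (hF.ind_ne_zero hp)).sum_update y)
      (x := fun i => Function.update (x i) y (c y))
      (fun i => by simpa only [Function.update_idem] using hGx i) (fun s => by
        by_cases hs : s = y
        · subst hs
          exact ⟨0, 1, by decide, by simp⟩
        · obtain ⟨i, j, hij, h⟩ := hx s
          exact ⟨i, j, hij, by simpa [hs] using h⟩)
    refine ⟨F', hF', fun i => ?_, fun a ha => ?_⟩
    · convert hFx' i using 3 with s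
      by_cases hs : s = y
      · subst hs; simp
      · simp [hs]
    · obtain ⟨b, hb, hFb⟩ := hFF' a ha
      obtain ⟨z, -, hz⟩ := Finset.exists_ne_zero_of_sum_ne_zero hFb
      refine ⟨Function.update b y z, fun s hs => ?_, fun h => hz (by simp [ind, h])⟩
      rw [Finset.mem_insert, not_or] at hs
      rw [Function.update_of_ne hs.1, hb s hs.2]

/-- At a variable of `U`, either one tuple can adopt the value of another and keep `F` nonzero, or
no such exchange is possible and the variable can be summed out without cancellation. -/
theorem exists_twoValued (h𝓗 : IsConservative 𝓗 p) (hp : p.Prime)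
    (U : Finset V) {F : ((x : V) → H (τ x)) → ZMod p}
    (hF : IsDefFun 𝓗 p τ F) {x : Fin 3 → (x : V) → H (τ x)} (hFx : ∀ i, F (x i) ≠ 0) :
    ∃ (F' : ((x : V) → H (τ x)) → ZMod p) (x' : Fin 3 → (x : V) → H (τ x)), IsDefFun 𝓗 p τ F' ∧
      (∀ i, F' (x' i) ≠ 0) ∧ (∀ s ∈ U, ∃ i j, i ≠ j ∧ x' i s = x' j s) ∧
      (∀ s ∉ U, ∀ i, x' i s = x i s) ∧
      ∀ a, F' a ≠ 0 → ∃ b, (∀ s ∉ U, b s = a s) ∧ F b ≠ 0 := by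
  induction U using Finset.induction_on generalizing F x with
  | empty =>
    exact ⟨F, x, hF, hFx, by simp, fun _ _ _ => rfl, fun a ha => ⟨a, fun _ _ => rfl, ha⟩⟩
  | insert y U hy ih =>
    obtain ⟨F₁, x₁, hF₁, hFx₁, hy₁, hx₁, hFF₁⟩ : ∃ (F' : ((x : V) → H (τ x)) → ZMod p)
        (x' : Fin 3 → (x : V) → H (τ x)), IsDefFun 𝓗 p τ F' ∧
        (∀ i, F' (x' i) ≠ 0) ∧ (∃ i j, i ≠ j ∧ x' i y = x' j y) ∧
        (∀ s ≠ y, ∀ i, x' i s = x i s) ∧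
        ∀ a, F' a ≠ 0 → ∃ b, (∀ s ≠ y, b s = a s) ∧ F b ≠ 0 := by
      by_cases h : ∃ i j, i ≠ j ∧ F (Function.update (x i) y (x j y)) ≠ 0
      · obtain ⟨i, j, hij, h⟩ := h
        refine ⟨F, Function.update x i (Function.update (x i) y (x j y)), hF, fun k => ?_,
          ⟨i, j, hij, by simp [hij.symm]⟩, fun s hs k => ?_, fun a ha => ⟨a, fun _ _ => rfl, ha⟩⟩
        all_goals
          by_cases hk : k = i
          · subst hk
            simp [*]
          · simp [*]
      · push Not at h
        -- With the sum restricted to the values of the three tuples, all exchanged terms vanish and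
        -- only the original value of `F` remains.
        have hval : ∀ i, ∑ z, ind p (z ∈ Set.range fun j => x j y) *
            F (Function.update (x i) y z) = F (x i) := fun i => by
          rw [Fintype.sum_eq_single (x i y)]
          · simp [ind]
          · intro z hz
            by_cases hz' : z ∈ Set.range fun j => x j y
            · obtain ⟨j, rfl⟩ := hz'
              rw [h i j (fun hij => hz (by simp [hij])), mul_zero]
            · rw [ind, if_neg hz', zero_mul]
        refine ⟨_, fun i => Function.update (x i) y (x 0 y),
          hF.sum_update_ind h𝓗 hp y (Set.range fun j => x j y), fun i => ?_,
          ⟨0, 1, by decide, by simp⟩, fun s hs i => by simp [hs], fun a ha => ?_⟩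
        · simpa only [Function.update_idem, hval] using hFx i
        · obtain ⟨z, -, hz⟩ := Finset.exists_ne_zero_of_sum_ne_zero ha
          exact ⟨_, fun s hs => Function.update_of_ne hs _ _, right_ne_zero_of_mul hz⟩
    obtain ⟨F', x', hF', hFx', hU', hx', hFF'⟩ := ih hF₁ hFx₁
    refine ⟨F', x', hF', hFx', fun s hs => ?_, fun s hs i => ?_, fun a ha => ?_⟩
    · rcases Finset.mem_insert.1 hs with rfl | hs
      · simpa only [hx' s hy] using hy₁
      · exact hU' s hs
    · rw [Finset.mem_insert, not_or] at hs
      rw [hx' s hs.2, hx₁ s hs.1]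
    · obtain ⟨b, hb, hFb⟩ := hFF' a ha
      obtain ⟨b', hb', hFb'⟩ := hFF₁ b hFb
      refine ⟨b', fun s hs => ?_, hFb'⟩
      rw [Finset.mem_insert, not_or] at hs
      rw [hb' s hs.1, hb s hs.2]

/-- Modular elimination of the variables `W`: the projection of a definable relation contains a
definable relation through three given tuples that take at most two values at each coordinate. -/
theorem exists_eliminate (h𝓗 : IsConservative 𝓗 p) (hp : p.Prime)
    (c : (x : V) → H (τ x)) (W : Finset V) {F : ((x : V) → H (τ x)) → ZMod p}
    (hF : IsDefFun 𝓗 p τ F) {x : Fin 3 → (x : V) → H (τ x)} (hFx : ∀ i, F (x i) ≠ 0)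
    (hx : ∀ s ∉ W, ∃ i j, i ≠ j ∧ x i s = x j s) :
    ∃ F' : ((x : V) → H (τ x)) → ZMod p, IsDefFun 𝓗 p τ F' ∧
      (∀ i, F' (fun s => if s ∈ W then c s else x i s) ≠ 0) ∧
      ∀ a, F' a ≠ 0 → ∃ b, (∀ s ∉ W, b s = a s) ∧ F b ≠ 0 := by
  obtain ⟨F₁, x₁, hF₁, hFx₁, hW, hx₁, hFF₁⟩ := exists_twoValued h𝓗 hp W hF hFx
  obtain ⟨F', hF', hFx', hFF'⟩ := exists_eliminate_of_twoValued h𝓗 hp c W hF₁ hFx₁ fun s => by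
    by_cases hs : s ∈ W
    · exact hW s hs
    · simpa only [hx₁ s hs] using hx s hs
  refine ⟨F', hF', fun i => ?_, fun a ha => ?_⟩
  · convert hFx' i using 3 with s
    split_ifs with hs
    · rfl
    · exact (hx₁ s hs i).symm
  · obtain ⟨b, hb, hFb⟩ := hFF' a ha
    obtain ⟨b', hb', hFb'⟩ := hFF₁ b hFb
    exact ⟨b', fun s hs => (hb' s hs).trans (hb s hs), hFb'⟩

end Elimination

/-! ### The indicator problem and the construction of an obstruction. -/

section Indicator

variable {ι : Type u} {H : ι → Type w} {σ : Signature.{u, v} ι} {𝓗 : RelStructure σ H} {p : ℕ}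

theorem ind_forall {κ : Type*} [Fintype κ] (P : κ → Prop) :
    ∏ k, ind p (P k) = ind p (∀ k, P k) := by
  by_cases h : ∀ k, P k
  · simp [ind, h]
  · obtain ⟨k, hk⟩ := not_forall.1 h
    rw [Finset.prod_eq_zero (Finset.mem_univ k) (if_neg hk), ind, if_neg h]

theorem isDefFun_indicator [Finite ι] [∀ i, Fintype (H i)] (hp : p.Prime)
    {σ' : Signature.{u, v'} ι} [Finite σ'.Symbol] (𝓖 : RelStructure σ' H)
    (h𝓖 : ∀ r, MppDefinable 𝓗 p (σ'.type r) (𝓖.rel r)) :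
    IsDefFun 𝓗 p (fun x : Triple H => x.1) fun g => ind p (g ∈ indicator 𝓖) := by
  let κ := {c : Σ r : σ'.Symbol, (q : Fin (σ'.arity r)) →
      H (σ'.type r q) × H (σ'.type r q) × H (σ'.type r q) //
    (fun q => (c.2 q).1) ∈ 𝓖.rel c.1 ∧ (fun q => (c.2 q).2.1) ∈ 𝓖.rel c.1 ∧
      (fun q => (c.2 q).2.2) ∈ 𝓖.rel c.1}
  have : Fintype κ := Fintype.ofFinite κ
  convert IsDefFun.prod (Finset.univ : Finset κ) fun c _ => ((h𝓖 c.1.1).isDefFun hp).subst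
    (τ' := fun x : Triple H => x.1) fun q => ⟨⟨σ'.type c.1.1 q, c.1.2 q⟩, rfl⟩ using 2 with g
  rw [ind_forall]
  congr 1
  exact propext ⟨fun h c => h _ _ c.2.1 c.2.2.1 c.2.2.2,
    fun h r t h₁ h₂ h₃ => h ⟨⟨r, t⟩, h₁, h₂, h₃⟩⟩

theorem rel_mppDefinable [∀ i, Fintype (H i)] (hp : p.Prime) (r : σ.Symbol) :
    MppDefinable 𝓗 p (σ.type r) (𝓗.rel r) := by
  have := Fact.mk hp
  exact mppDefinable_iff.2 ⟨_, .rel r, fun a => by simp [ind]⟩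

theorem dagger_mppDefinable [∀ i, Fintype (H i)] (hp : p.Prime)
    (r : (daggerSignature 𝓗 p).Symbol) :
    MppDefinable 𝓗 p ((daggerSignature 𝓗 p).type r) ((dagger 𝓗 p).rel r) :=
  match r with
  | .inl r => rel_mppDefinable hp r
  | .inr f => f.witness.definable

theorem finite_daggerSymbol [Finite ι] [∀ i, Finite (H i)] [Finite σ.Symbol] :
    Finite (daggerSignature 𝓗 p).Symbol := by
  have : Finite (TernaryOp H) :=
    inferInstanceAs (Finite ((i : ι) → H i → H i → H i → H i))
  have : Finite (BadPol 𝓗 p) :=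
    inferInstanceAs (Finite {f : TernaryOp H // f ∈ Pol3 𝓗 ∧ f ∉ Pol3Mpp 𝓗 p})
  exact inferInstanceAs (Finite (σ.Symbol ⊕ BadPol 𝓗 p))

/-- Each polymorphism of `𝓗` outside `Pol3Mpp 𝓗 p` is excluded by its own witness relation. -/
theorem pol3_dagger_subset : Pol3 (dagger 𝓗 p) ⊆ Pol3Mpp 𝓗 p := by
  intro f hf
  by_contra hf'
  let f' : BadPol 𝓗 p := ⟨f, fun r => hf (.inl r), hf'⟩
  exact Classical.choose_spec (not_forall.mp f'.2.2) (hf (.inr f'))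

/-- The three projections, as solutions of the ternary indicator problem. -/
def projections (H : ι → Type w) : Fin 3 → (x : Triple H) → H x.1 :=
  ![fun x => x.2.1, fun x => x.2.2.1, fun x => x.2.2.2]

theorem projections_mem_indicator (𝓗 : RelStructure σ H) (i : Fin 3) :
    projections H i ∈ indicator 𝓗 := by
  intro r t h₁ h₂ h₃
  fin_cases i
  exacts [h₁, h₂, h₃]

theorem notMem_setI_of_mem_setJ {x : Triple H} (hx : x ∈ setJ H) : x ∉ setI H := by
  rintro ⟨i, a, b, rfl⟩
  obtain ⟨j, c, d, hcd, h⟩ := hx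
  obtain rfl : i = j := congrArg Sigma.fst h
  simp only [Sigma.mk.injEq, heq_eq_eq, true_and, Prod.mk.injEq] at h
  exact hcd (h.2.2.symm.trans h.2.1)

theorem pairIJ_projections :
    pairIJ (tupA H) (tupC H) = (fun v : ↥(setI H ∪ setJ H) => projections H 0 v.1) ∧
    pairIJ (tupB H) (tupC H) = (fun v : ↥(setI H ∪ setJ H) => projections H 1 v.1) ∧
    pairIJ (tupB H) (tupD H) = (fun v : ↥(setI H ∪ setJ H) => projections H 2 v.1) := by
  refine ⟨?_, ?_, ?_⟩ <;> funext v <;> by_cases h : v.1 ∈ setI H <;>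
    rw [pairIJ] <;> simp only [h, dite_true, dite_false]
  · rfl
  · rfl
  · rfl
  · have hJ : ∀ x ∈ setJ H, x.2.1 = x.2.2.1 := by rintro _ ⟨i, a, b, -, rfl⟩; rfl
    exact hJ _ (v.2.resolve_left h)
  · have hI : ∀ x ∈ setI H, x.2.2.1 = x.2.2.2 := by rintro _ ⟨i, a, b, rfl⟩; rfl
    exact hI _ h
  · rfl

/-- Solutions of the indicator problem whose restriction is `(a_H, d_H)` are Mal'tsev
polymorphisms. -/
theorem hasMppMaltsev_of_mem_proj
    (h : pairIJ (tupA H) (tupD H) ∈ proj (setI H ∪ setJ H) (indicator (dagger 𝓗 p))) :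
    HasMppMaltsev 𝓗 p := by
  obtain ⟨g, hg, hgAD⟩ := h
  have hI : ∀ i (a b : H i), g ⟨i, (a, b, b)⟩ = a := fun i a b => by
    have hx : (⟨i, (a, b, b)⟩ : Triple H) ∈ setI H := ⟨i, a, b, rfl⟩
    exact (congrFun hgAD ⟨_, .inl hx⟩).trans (dif_pos hx)
  have hJ : ∀ i (a b : H i), a ≠ b → g ⟨i, (b, b, a)⟩ = a := fun i a b hab => by
    have hx : (⟨i, (b, b, a)⟩ : Triple H) ∈ setJ H := ⟨i, a, b, hab, rfl⟩
    exact (congrFun hgAD ⟨_, .inr hx⟩).trans (dif_neg (notMem_setI_of_mem_setJ hx))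
  refine ⟨fun i a b c => g ⟨i, (a, b, c)⟩, pol3_dagger_subset ?_, fun i a b => ⟨hI i a b, ?_⟩⟩
  · intro r a ha b hb c hc
    exact hg r (fun q => (a q, b q, c q)) ha hb hc
  · by_cases hab : a = b
    · subst hab
      exact hI i a a
    · exact hJ i a b hab

theorem hasMppMaltsev_or_admitsIndicatorObstruction [Finite ι] [∀ i, Finite (H i)]
    [Finite σ.Symbol] (hp : p.Prime) (h𝓗 : IsConservative 𝓗 p) :
    HasMppMaltsev 𝓗 p ∨ AdmitsIndicatorObstruction 𝓗 p := by
  have := fun i => Fintype.ofFinite (H i)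
  have : Fintype (Triple H) := Fintype.ofFinite _
  have := finite_daggerSymbol (𝓗 := 𝓗) (p := p)
  have := Fact.mk hp
  refine or_iff_not_imp_left.2 fun hM => ?_
  let K : Set (Triple H) := setI H ∪ setJ H
  let W : Finset (Triple H) := Finset.univ.filter (· ∉ K)
  obtain ⟨F, hF, hFx, hFK⟩ := exists_eliminate h𝓗 hp (projections H 0) W
    (isDefFun_indicator hp (dagger 𝓗 p) (dagger_mppDefinable hp)) (x := projections H)
    -- The kept coordinates are two-valued: the last two projections agree at (a, b, b), the first
    -- two at (b, b, a).
    (fun i => by simp [ind, projections_mem_indicator]) (fun s hs => by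
      have hs : s ∈ K := by simpa [W] using hs
      rcases hs with ⟨i, a, b, rfl⟩ | ⟨i, a, b, -, rfl⟩
      · exact ⟨1, 2, by decide, rfl⟩
      · exact ⟨0, 1, by decide, rfl⟩)
  -- The eliminated coordinates are frozen at the same constants that were passed to
  -- `exists_eliminate`, which leaves a function of the coordinates in `K` alone.
  let θ : (x : Triple H) → VarOfSort (fun v : K => v.1.1) x.1 ⊕ H x.1 := fun x =>
    if h : x ∈ K then .inl ⟨⟨x, h⟩, rfl⟩ else .inr (projections H 0 x)
  let ext : ((v : K) → H v.1.1) → (x : Triple H) → H x.1 := fun a x =>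
    Sum.elim (fun v => v.value a) id (θ x)
  have hext : ∀ a (v : K), ext a v.1 = a v := fun a v => by
    simp only [ext, show θ v.1 = .inl ⟨v, rfl⟩ from dif_pos v.2]
    rfl
  have hproj : ∀ i, ext (fun v => projections H i v.1) =
      fun s => if s ∈ W then projections H 0 s else projections H i s := fun i => by
    funext s
    by_cases hs : s ∈ K
    · rw [if_neg (by simpa [W] using hs)]
      exact hext _ ⟨s, hs⟩
    · rw [if_pos (by simpa [W] using hs)]
      simp only [ext, show θ s = .inr (projections H 0 s) from dif_neg hs]
      rfl
  let R : Set ((v : K) → H v.1.1) := {a | F (ext a) ≠ 0}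
  have hR : R ⊆ proj K (indicator (dagger 𝓗 p)) := by
    intro a ha
    obtain ⟨b, hb, hFb⟩ := hFK _ ha
    refine ⟨b, by_contra fun h => hFb (if_neg h), ?_⟩
    funext v
    exact (hb v.1 (by simp [W, v.2])).trans (hext a v)
  have hRx : ∀ i, (fun v : K => projections H i v.1) ∈ R := fun i => by
    change F (ext _) ≠ 0
    rw [hproj]
    convert hFx i
  refine ⟨R, ⟨hR, ?_, ?_, ?_, fun h => hM (hasMppMaltsev_of_mem_proj (hR h))⟩,
    mppDefinable_iff.2 ⟨_, hF.specialize h𝓗 hp θ, fun a => Iff.rfl⟩⟩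
  · rw [pairIJ_projections.1]; exact hRx 0
  · rw [pairIJ_projections.2.1]; exact hRx 1
  · rw [pairIJ_projections.2.2]; exact hRx 2

end Indicator

/-! ### Obstructions contradict strong rectangularity. -/

section Rectangularity

variable {ι : Type u} {H : ι → Type w} {σ : Signature.{u, v} ι} {𝓗 : RelStructure σ H} {p : ℕ}

/-- In a strongly rectangular structure, relations with an arbitrary finite set of at least two
coordinates are rectangular. -/
theorem IsStronglyRectangular.isRectangular [∀ i, Finite (H i)]
    (h : IsStronglyRectangular 𝓗 p) {V : Type*} [Finite V] {τ : V → ι}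
    {R : Set ((x : V) → H (τ x))} (hR : MppDefinable 𝓗 p τ R) (hV : 2 ≤ Nat.card V) :
    IsRectangular R := by
  have := fun i => Fintype.ofFinite (H i)
  intro I hI a b c d hac had hbc
  let e := (Finite.equivFin V).symm
  let θ : (x : V) → VarOfSort (τ ∘ e) (τ x) := fun x => ⟨e.symm x, by simp⟩
  have hθ : ∀ g : (x : V) → H (τ x), (fun x => (θ x).value fun q => g (e q)) = g := fun g => by
    funext x
    have : ∀ (y : V) (hy : τ y = τ x), y = x → (hy ▸ g y : H (τ x)) = g x := by
      rintro y hy rfl; rfl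
    exact this (e (e.symm x)) _ (by simp)
  obtain ⟨F, hF, hRF⟩ := mppDefinable_iff.1 hR
  let Q : MppRelation 𝓗 p :=
    { arity := Nat.card V
      type := τ ∘ e
      rel := {g | (fun x => (θ x).value g) ∈ R}
      definable := mppDefinable_iff.2 ⟨_, hF.subst θ, fun g => hRF _⟩ }
  have hglue : ∀ (a : (x : I) → H (τ x)) (c : (x : (Iᶜ : Set V)) → H (τ x)),
      glue (τ := τ ∘ e) (e ⁻¹' I) (fun q => a ⟨e q, q.2⟩) (fun q => c ⟨e q, q.2⟩) ∈ Q.rel ↔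
        glue I a c ∈ R := fun a c => by
    have : glue (τ := τ ∘ e) (e ⁻¹' I) (fun q => a ⟨e q, q.2⟩) (fun q => c ⟨e q, q.2⟩) =
        fun q => glue I a c (e q) := rfl
    rw [this]
    change (fun x => (θ x).value fun q => glue I a c (e q)) ∈ R ↔ _
    rw [hθ]
  rw [← hglue] at hac had hbc ⊢
  exact h Q hV (e ⁻¹' I) (fun hu => hI (Set.eq_univ_of_forall fun x => by
    simpa using Set.eq_univ_iff_forall.1 hu (e.symm x))) _ _ _ _ hac had hbc

theorem AdmitsIndicatorObstruction.not_isStronglyRectangular [Finite ι] [∀ i, Finite (H i)]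
    (h : AdmitsIndicatorObstruction 𝓗 p) : ¬ IsStronglyRectangular 𝓗 p := by
  obtain ⟨R, ⟨-, hAC, hBC, hBD, hAD⟩, hR⟩ := h
  intro hrect
  let K : Set (Triple H) := setI H ∪ setJ H
  let I : Set K := {v | v.1 ∈ setI H}
  have hpair : ∀ (x : (v : setI H) → H v.1.1) (y : (v : setJ H) → H v.1.1),
      pairIJ x y = glue (τ := fun v : K => v.1.1) I (fun v => x ⟨v.1.1, v.2⟩)
        (fun v => y ⟨v.1.1, v.1.2.resolve_left v.2⟩) := fun x y => rfl
  -- Both parts are nonempty, since otherwise (a, d) would coincide with (b, d) or (a, c), which lie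
  -- in `R`. Hence the arity is at least 2 and `I` is proper.
  obtain ⟨v, hv⟩ : ∃ v : K, v.1 ∈ setI H := by
    by_contra! h
    refine hAD ?_
    convert hBD using 1
    funext v
    simp only [pairIJ, dif_neg (h v)]
  obtain ⟨v', hv'⟩ : ∃ v : K, v.1 ∉ setI H := by
    by_contra! h
    refine hAD ?_
    convert hAC using 1
    funext v
    simp only [pairIJ, dif_pos (h v)]
  have hK : 2 ≤ Nat.card K :=
    have : Nontrivial K := ⟨v, v', fun h => hv' (h ▸ hv)⟩
    Finite.one_lt_card
  have hI : I ≠ Set.univ := fun hI => hv' (hI.symm ▸ Set.mem_univ v' : v' ∈ I)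
  rw [hpair] at hAC hBC hBD hAD
  exact hAD (hrect.isRectangular hR hK I hI _ _ _ _ hBC hBD hAC)

end Rectangularity

end ModCSP

theorem theorem4p8 {ι : Type*} [Finite ι] {H : ι → Type*} [∀ i, Finite (H i)]
    {σ : ModCSP.Signature ι} [Finite σ.Symbol] (𝓗 : ModCSP.RelStructure σ H)
    (p : ℕ) (hp : p.Prime) (h𝓗 : ModCSP.IsConservative 𝓗 p) :
    (ModCSP.HasMppMaltsev 𝓗 p ∨ ModCSP.AdmitsIndicatorObstruction 𝓗 p) ∧
      (ModCSP.AdmitsIndicatorObstruction 𝓗 p → ¬ ModCSP.IsStronglyRectangular 𝓗 p) :=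
  ⟨ModCSP.hasMppMaltsev_or_admitsIndicatorObstruction hp h𝓗,
    ModCSP.AdmitsIndicatorObstruction.not_isStronglyRectangular⟩
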